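/- Let $G=(V,E)$ be a finite simple graph with $n=|V|$ vertices and maximum degree $\Delta$, and let $l_v\in\{0,1\}$, $v\in V$, be parities with $\sum_{v\in V} l_v\equiv 1 \pmod 2$. The Tseitin formula $\Phi$ of $(G,l)$ is the CNF formula with one variable $x_e$ per edge $e\in E$ that expresses $\sum_{e\ni v}x_e\equiv l_v \pmod 2$ for all $v\in V$: for every vertex $v$ and every set $S$ of edges at $v$ with $|S|\not\equiv l_v\pmod 2$ it has the clause $\bigvee_{e\ni v,\,e\notin S}x_e\vee\bigvee_{e\in S}\bar x_e$. Let $K_\Phi\subseteq[0,1]^E$ be its continuous relaxation, in which each clause with sets $P$ and $N$ of positive and negated variables becomes the inequality $\sum_{e\in P}x_e+\sum_{e\in N}(1-x_e)\ge 1$. For $K\subseteq\mathbb R^E$ and $a\in\mathbb Z^E$ let $\mathrm{CG}(K,a)=\{x\in K: a x\le\lfloor\sup_{z\in K}a z\rfloor\}$. A cutting-planes (CP) refutation of $\Phi$ of length $N$ is a list $a_1,\dots,a_N\in\mathbb Z^E$ such that applying the cuts $\mathrm{CG}(\cdot,a_1),\dots,\mathrm{CG}(\cdot,a_N)$ to $K_\Phi$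 in this order yields the empty set. Then $\Phi$ has a CP refutation of length $2^{\Delta}(n\Delta)^{O(\log n)}$. That is, there is an absolute constant $C>0$ such that for all $G$ and $l$ as above, $\Phi$ has a CP refutation of length at most $2^{\Delta}(n\Delta)^{C\log n}$. -/

import Mathlib

/-- A clause over the variables `X`: the disjunction of the literals `x i`, `i ∈ pos`, and of the
negated literals `¬ x i`, `i ∈ neg`. -/
structure Clause (X : Type*) where
  pos : Finset X
  neg : Finset X

/-- A formula in conjunctive normal form, as its set of clauses. -/
abbrev CNF (X : Type*) := Set (Clause X)

/-- The continuous relaxation of a CNF formula: the points of the cube `[0,1]^X` that satisfy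
`∑ i ∈ pos, x i + ∑ i ∈ neg, (1 - x i) ≥ 1` for every clause. -/
def satPolytope {X : Type*} (Φ : CNF X) : Set (X → ℝ) :=
  {x | (∀ c ∈ Φ, 1 ≤ ∑ i ∈ c.pos, x i + ∑ i ∈ c.neg, (1 - x i)) ∧
    ∀ i, 0 ≤ x i ∧ x i ≤ 1}

/-- The linear form with integer coefficient vector `a`. -/
def intForm {X : Type*} [Fintype X] (a : X → ℤ) (x : X → ℝ) : ℝ := ∑ i, (a i : ℝ) * x i

/-- The result of applying to `K` the Chvátal-Gomory cut induced by `a`, that is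
`{x ∈ K | a x ≤ ⌊sup_{z ∈ K} a z⌋}`. If the supremum is infinite the cut is vacuous. -/
noncomputable def cgCut {X : Type*} [Fintype X] (K : Set (X → ℝ)) (a : X → ℤ) : Set (X → ℝ) :=
  {x ∈ K | BddAbove (intForm a '' K) → intForm a x ≤ (⌊sSup (intForm a '' K)⌋ : ℤ)}

/-- The result of applying to `K` the Chvátal-Gomory cuts induced by the vectors of a list, one by
one, from left to right. -/
noncomputable def cgCuts {X : Type*} [Fintype X] (K : Set (X → ℝ)) (L : List (X → ℤ)) :
    Set (X → ℝ) :=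
  L.foldl cgCut K

/-- `L` is a cutting-planes proof of integer infeasibility for `K`; its length is `L.length`. -/
def IsCPProof {X : Type*} [Fintype X] (K : Set (X → ℝ)) (L : List (X → ℤ)) : Prop :=
  cgCuts K L = ∅

/-- `L` is a cutting-planes refutation of the formula `Φ`. -/
def IsCPRefutation {X : Type*} [Fintype X] (Φ : CNF X) (L : List (X → ℤ)) : Prop :=
  IsCPProof (satPolytope Φ) L

/-- The edges of `G` that contain the vertex `v`. -/
def edgesAt {V : Type*} [Fintype V] [DecidableEq V] (G : SimpleGraph V) [DecidableRel G.Adj]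
    (v : V) : Finset G.edgeSet :=
  Finset.univ.filter fun e => v ∈ (e : Sym2 V)

/-- The Tseitin formula of the graph `G` with parities `l`. Its variables are the edges of `G`.
For each vertex `v`, the constraint that the sum of the variables at `v` is `l v` modulo 2 is
written in conjunctive normal form: for each set `S` of edges at `v` whose size has the wrong
parity there is one clause, which forbids the assignment that is 1 on `S` and 0 on the other edges
at `v`. -/
def tseitin {V : Type*} [Fintype V] [DecidableEq V] (G : SimpleGraph V) [DecidableRel G.Adj]
    (l : V → ZMod 2) : CNF G.edgeSet :=
  {c | ∃ v : V, ∃ S ⊆ edgesAt G v, (S.card : ZMod 2) ≠ l v ∧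
    c = { pos := edgesAt G v \ S, neg := S }}

/-! For `U ⊆ V` let `x(δU)` be the sum of `x` over the edges leaving `U`. A 0/1 solution would give
it the parity of `∑ v ∈ U, l v`. For `U = V` it is identically 0 although the parities sum to 1, and
this contradiction is located by binary search.

Suppose `x(δU) = k` with `k` of the wrong parity. Split `U` into halves `U₁`, `U₂` and enumerate the
integer values `k₁`, `k₂` of their boundary sums. If one of them has the wrong parity, recurse into
that half. Otherwise `x(δU₁) + x(δU₂) = x(δU) + 2 b x`, with `b` the indicator of the edges between
the halves, fixes `b x` at a half-integer, and one cut suffices. At a single vertex, branching on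
its at most Δ edges violates a clause. With `m` edges each of the `⌈log₂ n⌉` levels costs a factor
`(m + 1) ^ 2`, and a leaf costs about `2 ^ Δ` (`cpRefutable_boundary`).

Cutting planes can simulate this branching because cuts of a face lift to the whole set
(`exists_cgCuts_face`): refute the top face, cut down by one, repeat (`CPRefutable.of_forall_face`).
-/

/-! ### Chvátal-Gomory cuts of compact sets -/

section Cuts

variable {X : Type*} [Fintype X]

lemma continuous_intForm (a : X → ℤ) : Continuous (intForm a) := by
  unfold intForm
  fun_prop

lemma intForm_add (a b : X → ℤ) (x : X → ℝ) :
    intForm (a + b) x = intForm a x + intForm b x := by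
  simp [intForm, add_mul, Finset.sum_add_distrib]

lemma intForm_nsmul (t : ℕ) (a : X → ℤ) (x : X → ℝ) :
    intForm (t • a) x = t * intForm a x := by
  simp [intForm, mul_assoc, Finset.mul_sum]

lemma intForm_single [DecidableEq X] (i : X) (x : X → ℝ) :
    intForm (Pi.single i 1) x = x i := by
  simp [intForm, Pi.single_apply]

lemma bddAbove_intForm {K : Set (X → ℝ)} (hK : IsCompact K) (a : X → ℤ) :
    BddAbove (intForm a '' K) :=
  (hK.image (continuous_intForm a)).bddAbove

lemma cgCut_subset (K : Set (X → ℝ)) (a : X → ℤ) : cgCut K a ⊆ K := fun _ hx => hx.1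

lemma cgCuts_subset (K : Set (X → ℝ)) (L : List (X → ℤ)) : cgCuts K L ⊆ K := by
  induction L generalizing K with
  | nil => exact subset_rfl
  | cons a L ih => exact (ih (cgCut K a)).trans (cgCut_subset K a)

lemma cgCuts_append (K : Set (X → ℝ)) (L M : List (X → ℤ)) :
    cgCuts K (L ++ M) = cgCuts (cgCuts K L) M := by
  simp [cgCuts]

lemma IsCompact.cgCut {K : Set (X → ℝ)} (hK : IsCompact K) (a : X → ℤ) :
    IsCompact (cgCut K a) := by
  have h : _root_.cgCut K a = K ∩ {x | intForm a x ≤ (⌊sSup (intForm a '' K)⌋ : ℤ)} := by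
    ext x
    simp [_root_.cgCut, bddAbove_intForm hK a]
  rw [h]
  exact hK.inter_right (isClosed_le (continuous_intForm a) continuous_const)

lemma IsCompact.cgCuts {K : Set (X → ℝ)} (hK : IsCompact K) (L : List (X → ℤ)) :
    IsCompact (cgCuts K L) := by
  induction L generalizing K with
  | nil => exact hK
  | cons a L ih => exact ih (hK.cgCut a)

/-- A smaller set has a smaller supremum, hence a deeper cut. This is why refutations pass to
subsets. -/
lemma cgCut_mono {K K' : Set (X → ℝ)} (hK : IsCompact K) (h : K' ⊆ K) (a : X → ℤ) :
    cgCut K' a ⊆ cgCut K a := by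
  intro x hx
  have hb := bddAbove_intForm hK a
  have hb' : BddAbove (intForm a '' K') := hb.mono (Set.image_mono h)
  refine ⟨h hx.1, fun _ => (hx.2 hb').trans ?_⟩
  exact_mod_cast Int.floor_le_floor
    (csSup_le_csSup hb ⟨_, Set.mem_image_of_mem _ hx.1⟩ (Set.image_mono h))

lemma cgCuts_mono {K K' : Set (X → ℝ)} (hK : IsCompact K) (h : K' ⊆ K) (L : List (X → ℤ)) :
    cgCuts K' L ⊆ cgCuts K L := by
  induction L generalizing K K' with
  | nil => exact h
  | cons a L ih => exact ih (hK.cgCut a) (cgCut_mono hK h a)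

/-- A strict integer upper bound of a form on a compact set is improved by one by a cut. -/
lemma intForm_le_of_mem_cgCut {K : Set (X → ℝ)} (hK : IsCompact K) {a : X → ℤ} {m : ℤ}
    (h : ∀ x ∈ K, intForm a x < m) {x : X → ℝ} (hx : x ∈ cgCut K a) :
    intForm a x ≤ (m - 1 : ℤ) := by
  refine (hx.2 (bddAbove_intForm hK a)).trans ?_
  -- Compactness makes the supremum a value on `K`, so it is strictly below `m` as well.
  obtain ⟨y, hy, hys⟩ := hK.exists_sSup_image_eq ⟨x, hx.1⟩ (continuous_intForm a).continuousOn
  rw [hys]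
  exact_mod_cast Int.le_sub_one_of_lt (Int.floor_lt.2 (h y hy))

/-! ### Lifting cuts from a face -/

/-- A cut of a face lifts to a cut of the whole set. -/
lemma exists_cgCut_face {K : Set (X → ℝ)} (hK : IsCompact K) {a : X → ℤ} {b : ℤ}
    (hb : ∀ x ∈ K, intForm a x ≤ b) (c : X → ℤ) :
    ∃ c' : X → ℤ, cgCut K c' ∩ {x | intForm a x = b} ⊆
      cgCut (K ∩ {x | intForm a x = b}) c := by
  set F := K ∩ {x | intForm a x = b} with hF
  have hFc : IsCompact F :=
    hK.inter_right (isClosed_eq (continuous_intForm a) continuous_const)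
  set m : ℤ := ⌊sSup (intForm c '' F)⌋ + 1 with hm
  -- The lifted cut is `c + t • a`: a large `t` penalises points off the face and adds only the
  -- constant `t * b` on it. Each point has its own `t`; compactness leaves finitely many, and their
  -- maximum works since `intForm a y - b ≤ 0`.
  obtain ⟨t, ht⟩ : ∃ t : ℕ, ∀ x ∈ K, intForm c x + t * (intForm a x - b) < m := by
    have hcover : ∀ x ∈ K, ∃ t : ℕ, intForm c x + t * (intForm a x - b) < m := by
      intro x hx
      rcases (hb x hx).lt_or_eq with h | h
      · obtain ⟨t, ht⟩ := exists_nat_gt ((intForm c x - m) / (b - intForm a x))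
        rw [div_lt_iff₀ (by linarith)] at ht
        exact ⟨t, by linarith⟩
      · refine ⟨0, ?_⟩
        have h1 : intForm c x ≤ sSup (intForm c '' F) :=
          le_csSup (bddAbove_intForm hFc c) ⟨x, ⟨hx, h⟩, rfl⟩
        have h2 := Int.lt_floor_add_one (sSup (intForm c '' F))
        simp only [hm, Nat.cast_zero, zero_mul, add_zero, Int.cast_add, Int.cast_one]
        linarith
    choose! τ hτ using hcover
    obtain ⟨s, hsK, hs⟩ := hK.elim_nhds_subcover
      (fun x => {y | intForm c y + τ x * (intForm a y - b) < m}) (fun x hx => by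
        refine IsOpen.mem_nhds (isOpen_lt ?_ continuous_const) (hτ x hx)
        have := continuous_intForm a
        have := continuous_intForm c
        fun_prop)
    refine ⟨s.sup τ, fun y hy => ?_⟩
    obtain ⟨x, hxs, hxy⟩ := Set.mem_iUnion₂.1 (hs hy)
    have h1 : (τ x : ℝ) ≤ (s.sup τ : ℕ) := by exact_mod_cast Finset.le_sup hxs
    have h2 := hb y hy
    have h3 : intForm c y + τ x * (intForm a y - b) < m := hxy
    nlinarith
  refine ⟨c + t • a, fun x hx => ⟨⟨hx.1.1, hx.2⟩, fun _ => ?_⟩⟩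
  have hlt : ∀ y ∈ K, intForm (c + t • a) y < (m + t * b : ℤ) := by
    intro y hy
    have := ht y hy
    rw [intForm_add, intForm_nsmul]
    push_cast
    linarith
  have hle := intForm_le_of_mem_cgCut hK hlt hx.1
  have hxa : intForm a x = b := hx.2
  rw [intForm_add, intForm_nsmul, hxa] at hle
  push_cast [hm] at hle
  linarith

/-- A sequence of cuts of a face lifts to a sequence of cuts of the whole set. -/
lemma exists_cgCuts_face {K : Set (X → ℝ)} (hK : IsCompact K) {a : X → ℤ} {b : ℤ}
    (hb : ∀ x ∈ K, intForm a x ≤ b) (L : List (X → ℤ)) :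
    ∃ L' : List (X → ℤ), L'.length = L.length ∧ cgCuts K L' ∩ {x | intForm a x = b} ⊆
      cgCuts (K ∩ {x | intForm a x = b}) L := by
  have hface : IsClosed {x | intForm a x = b} :=
    isClosed_eq (continuous_intForm a) continuous_const
  -- A lifted cut may remove more of the face than the original one, so the induction carries an
  -- inclusion instead of an equality.
  suffices H : ∀ K₁ F : Set (X → ℝ), IsCompact K₁ → IsCompact F →
      (∀ x ∈ K₁, intForm a x ≤ b) → K₁ ∩ {x | intForm a x = b} ⊆ F →
      ∃ L' : List (X → ℤ), L'.length = L.length ∧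
        cgCuts K₁ L' ∩ {x | intForm a x = b} ⊆ cgCuts F L from
    H K _ hK (hK.inter_right hface) hb subset_rfl
  induction L with
  | nil => exact fun K₁ F _ _ _ h => ⟨[], rfl, h⟩
  | cons c L ih =>
    intro K₁ F hK₁ hFc hb₁ hsub
    obtain ⟨c', hc'⟩ := exists_cgCut_face hK₁ hb₁ c
    obtain ⟨L', hlen, hL'⟩ := ih (cgCut K₁ c') (cgCut F c) (hK₁.cgCut c') (hFc.cgCut c)
      (fun x hx => hb₁ x hx.1) (hc'.trans (cgCut_mono hFc hsub c))
    exact ⟨c' :: L', by simp [hlen], hL'⟩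

/-! ### Refutation by branching on integer values -/

/-- `K` has a cutting-planes proof of integer infeasibility of length at most `N`. -/
def CPRefutable (K : Set (X → ℝ)) (N : ℕ) : Prop :=
  ∃ L : List (X → ℤ), IsCPProof K L ∧ L.length ≤ N

lemma CPRefutable.mono {K K' : Set (X → ℝ)} {N N' : ℕ} (h : CPRefutable K N)
    (hK : IsCompact K) (hsub : K' ⊆ K) (hN : N ≤ N') : CPRefutable K' N' := by
  obtain ⟨L, hL, hlen⟩ := h
  exact ⟨L, Set.subset_empty_iff.1 ((cgCuts_mono hK hsub L).trans hL.subset), hlen.trans hN⟩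

lemma cpRefutable_of_eq_empty {K : Set (X → ℝ)} (h : K = ∅) (N : ℕ) : CPRefutable K N :=
  ⟨[], h, Nat.zero_le N⟩

/-- If a form is constant on `K` and its value is not an integer, one cut refutes `K`. -/
lemma cpRefutable_of_forall_ne_int {K : Set (X → ℝ)} {a : X → ℤ} {r : ℝ}
    (hr : ∀ k : ℤ, r ≠ k) (h : ∀ x ∈ K, intForm a x = r) : CPRefutable K 1 := by
  refine ⟨[a], Set.eq_empty_iff_forall_notMem.2 fun x hx => ?_, le_rfl⟩
  have hx' : x ∈ cgCut K a := hx
  have himg : intForm a '' K = {r} := by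
    ext y
    constructor
    · rintro ⟨z, hz, rfl⟩
      exact h z hz
    · rintro rfl
      exact ⟨x, hx'.1, h x hx'.1⟩
  have hle := hx'.2 (by rw [himg]; exact bddAbove_singleton)
  rw [himg, csSup_singleton, h x hx'.1] at hle
  exact hr _ (le_antisymm hle (Int.floor_le r))

/-- If the top face of `K` is refutable then `K` reduces to its part below that face. -/
lemma CPRefutable.of_face {K : Set (X → ℝ)} (hK : IsCompact K) {a : X → ℤ} {b : ℤ}
    (hb : ∀ x ∈ K, intForm a x ≤ b) {N M : ℕ}
    (hface : CPRefutable (K ∩ {x | intForm a x = b}) N)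
    (hrest : CPRefutable (K ∩ {x | intForm a x ≤ (b - 1 : ℤ)}) M) :
    CPRefutable K (N + 1 + M) := by
  obtain ⟨L, hL, hlen⟩ := hface
  obtain ⟨M', hM', hlenM⟩ := hrest
  obtain ⟨L', hlen', hL'⟩ := exists_cgCuts_face hK hb L
  have hlt : ∀ x ∈ cgCuts K L', intForm a x < b := by
    intro x hx
    refine (hb x (cgCuts_subset K L' hx)).lt_of_ne fun h => ?_
    have hmem := hL' ⟨hx, h⟩
    rw [show cgCuts _ L = ∅ from hL] at hmem
    exact hmem
  have hsub : cgCut (cgCuts K L') a ⊆ K ∩ {x | intForm a x ≤ (b - 1 : ℤ)} := fun x hx =>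
    ⟨cgCuts_subset K L' hx.1, intForm_le_of_mem_cgCut (hK.cgCuts L') hlt hx⟩
  have hcomp : IsCompact (K ∩ {x | intForm a x ≤ (b - 1 : ℤ)}) :=
    hK.inter_right (isClosed_le (continuous_intForm a) continuous_const)
  refine ⟨L' ++ a :: M', ?_, ?_⟩
  · rw [IsCPProof, cgCuts_append]
    exact Set.subset_empty_iff.1 ((cgCuts_mono hcomp hsub M').trans hM'.subset)
  · simp only [List.length_append, List.length_cons]
    omega

/-- Enumeration of the integer values of a form. -/
lemma CPRefutable.of_forall_face {K : Set (X → ℝ)} (hK : IsCompact K) {a : X → ℤ} {M N Q : ℕ}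
    (h0 : ∀ x ∈ K, 0 ≤ intForm a x) (hM : ∀ x ∈ K, intForm a x ≤ M)
    (h : ∀ k : ℤ, CPRefutable (K ∩ {x | intForm a x = k}) N)
    -- `M + 1` faces at `N` cuts each and `M` cuts between them: `(M + 1) * (N + 1) - 1` in all.
    (hQ : (M + 1) * (N + 1) ≤ Q + 1) : CPRefutable K Q := by
  induction M generalizing K Q with
  | zero =>
    refine (h 0).mono (hK.inter_right (isClosed_eq (continuous_intForm a) continuous_const))
      (fun x hx => ⟨hx, ?_⟩) (by omega)
    have h1 := hM x hx
    have h2 := h0 x hx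
    push_cast at h1
    simp only [Set.mem_ofPred_eq, Int.cast_zero]
    linarith
  | succ M ih =>
    have hclosed : IsClosed {x | intForm a x ≤ (((M + 1 : ℕ) : ℤ) - 1 : ℤ)} :=
      isClosed_le (continuous_intForm a) continuous_const
    have hexp : (M + 1) * (N + 1) = ((M + 1) * (N + 1) - 1) + 1 :=
      (Nat.sub_add_cancel (Nat.mul_pos M.succ_pos N.succ_pos)).symm
    have hrest : CPRefutable (K ∩ {x | intForm a x ≤ (((M + 1 : ℕ) : ℤ) - 1 : ℤ)})
        ((M + 1) * (N + 1) - 1) := by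
      refine ih (hK.inter_right hclosed) (fun x hx => h0 x hx.1) (fun x hx => ?_) (fun k => ?_)
        hexp.le
      · simpa using hx.2
      · exact (h k).mono (hK.inter_right (isClosed_eq (continuous_intForm a) continuous_const))
          (Set.inter_subset_inter_left _ Set.inter_subset_left) le_rfl
    refine (CPRefutable.of_face hK (b := ((M + 1 : ℕ) : ℤ)) (fun x hx => by simpa using hM x hx)
      (h _) hrest).mono hK subset_rfl ?_
    have : (M + 1 + 1) * (N + 1) = (M + 1) * (N + 1) + (N + 1) := by ring
    omega

/-- Branching on the 0/1 values of the variables in `T`. -/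
lemma cpRefutable_of_forall_assignment [DecidableEq X] (T : Finset X) {K : Set (X → ℝ)}
    (hK : IsCompact K) (h01 : ∀ x ∈ K, ∀ i, 0 ≤ x i ∧ x i ≤ 1)
    (h : ∀ S ⊆ T, ∀ x ∈ K, (∀ i ∈ S, x i = 1) → (∀ i ∈ T \ S, x i = 0) → False) :
    CPRefutable K (2 ^ T.card - 1) := by
  induction T using Finset.induction_on generalizing K with
  | empty =>
    exact cpRefutable_of_eq_empty
      (Set.eq_empty_iff_forall_notMem.2 fun x hx => h ∅ subset_rfl x hx (by simp) (by simp)) _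
  | insert j T hj ih =>
    have hpos : 0 < 2 ^ T.card := by positivity
    refine CPRefutable.of_forall_face (a := Pi.single j 1) (M := 1) (N := 2 ^ T.card - 1) hK
      (fun x hx => ?_) (fun x hx => ?_) (fun k => ?_) ?_
    · rw [intForm_single]; exact (h01 x hx j).1
    · rw [intForm_single]; exact_mod_cast (h01 x hx j).2
    · refine ih (hK.inter_right (isClosed_eq (continuous_intForm _) continuous_const))
        (fun x hx => h01 x hx.1) fun S hS x hx h1 h0 => ?_
      have hxj : x j = k := by simpa [intForm_single] using hx.2
      have hk0 : 0 ≤ k := by exact_mod_cast hxj ▸ (h01 x hx.1 j).1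
      have hk1 : k ≤ 1 := by exact_mod_cast hxj ▸ (h01 x hx.1 j).2
      obtain rfl | rfl : k = 0 ∨ k = 1 := by omega
      · refine h S (hS.trans (Finset.subset_insert j T)) x hx.1 h1 fun i hi => ?_
        rw [Finset.mem_sdiff, Finset.mem_insert] at hi
        rcases hi.1 with rfl | hi'
        · simpa using hxj
        · exact h0 i (Finset.mem_sdiff.2 ⟨hi', hi.2⟩)
      · refine h (insert j S) (Finset.insert_subset_insert j hS) x hx.1 (fun i hi => ?_)
          fun i hi => ?_
        · rcases Finset.mem_insert.1 hi with rfl | hi'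
          · simpa using hxj
          · exact h1 i hi'
        · rw [Finset.mem_sdiff, Finset.mem_insert, Finset.mem_insert, not_or] at hi
          exact h0 i (Finset.mem_sdiff.2 ⟨hi.1.resolve_left hi.2.1, hi.2.2⟩)
    · rw [Finset.card_insert_of_notMem hj, pow_succ]
      omega

lemma isCompact_satPolytope {X : Type*} (Φ : CNF X) : IsCompact (satPolytope Φ) := by
  have h : satPolytope Φ = Set.Icc 0 1 ∩
      ⋂ c ∈ Φ, {x | 1 ≤ ∑ i ∈ c.pos, x i + ∑ i ∈ c.neg, (1 - x i)} := by
    ext x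
    simp only [satPolytope, Set.mem_ofPred_eq, Set.mem_inter_iff, Set.mem_Icc, Set.mem_iInter,
      Pi.le_def, Pi.zero_apply, Pi.one_apply, ← forall_and]
    exact and_comm
  rw [h]
  refine isCompact_Icc.inter_right (isClosed_biInter fun c _ => ?_)
  exact isClosed_le continuous_const (by fun_prop)

end Cuts

/-! ### Tseitin formulas -/

lemma card_edgeSet_le {V : Type*} [Fintype V] (G : SimpleGraph V) [DecidableRel G.Adj] :
    Fintype.card G.edgeSet ≤ Fintype.card V * G.maxDegree := by
  have h1 := G.sum_degrees_eq_twice_card_edges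
  have h2 : ∑ v, G.degree v ≤ ∑ _v : V, G.maxDegree :=
    Finset.sum_le_sum fun v _ => G.degree_le_maxDegree v
  have h3 : Fintype.card G.edgeSet = G.edgeFinset.card := by
    rw [SimpleGraph.edgeFinset, Set.toFinset_card]
  simp only [Finset.sum_const, Finset.card_univ, smul_eq_mul] at h2
  omega

section Tseitin

variable {V : Type*} [DecidableEq V] (G : SimpleGraph V)

/-- The number of end vertices of an edge in a vertex set. -/
def endsIn (U : Finset V) (e : G.edgeSet) : ℕ := (U.filter fun v => v ∈ (e : Sym2 V)).card

/-- The indicator vector of the edges with exactly one end vertex in `U`. -/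
def boundaryForm (U : Finset V) : G.edgeSet → ℤ := fun e => (endsIn G U e % 2 : ℕ)

lemma endsIn_union {U W : Finset V} (h : Disjoint U W) (e : G.edgeSet) :
    endsIn G (U ∪ W) e = endsIn G U e + endsIn G W e := by
  rw [endsIn, Finset.filter_union,
    Finset.card_union_of_disjoint (Finset.disjoint_filter_filter h), endsIn, endsIn]

/-- An edge counts twice on the left and not at all in the boundary of the union exactly when it
joins `U` to `W`; `b` is the indicator of these edges. -/
lemma exists_boundaryForm_add {U W : Finset V} (h : Disjoint U W) :
    ∃ b : G.edgeSet → ℤ, boundaryForm G U + boundaryForm G W =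
      boundaryForm G (U ∪ W) + 2 • b := by
  refine ⟨fun e => (boundaryForm G U e + boundaryForm G W e - boundaryForm G (U ∪ W) e) / 2, ?_⟩
  ext e
  simp only [Pi.add_apply, boundaryForm, endsIn_union G h, two_nsmul]
  omega

lemma boundaryForm_empty : boundaryForm G ∅ = 0 := by
  ext e
  simp [boundaryForm, endsIn]

lemma boundaryForm_univ [Fintype V] : boundaryForm G Finset.univ = 0 := by
  ext ⟨e, he⟩
  induction e with
  | _ a b =>
    have hab : a ≠ b := G.ne_of_adj he
    have h : (Finset.univ.filter fun v => v ∈ s(a, b)) = {a, b} := by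
      ext v
      simp
    rw [boundaryForm, endsIn, h, Finset.card_pair hab]
    rfl

variable [Fintype V] [DecidableRel G.Adj]

lemma boundaryForm_singleton (v : V) (e : G.edgeSet) :
    boundaryForm G {v} e = if e ∈ edgesAt G v then 1 else 0 := by
  by_cases h : v ∈ (e : Sym2 V) <;>
    simp [boundaryForm, endsIn, edgesAt, Finset.filter_singleton, h]

lemma card_edgesAt (v : V) : (edgesAt G v).card = G.degree v := by
  rw [← G.card_incidenceFinset_eq_degree]
  refine Finset.card_bij (fun e _ => (e : Sym2 V)) (fun e he => ?_)
    (fun _ _ _ _ h => Subtype.ext h) fun e he => ?_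
  · rw [SimpleGraph.mem_incidenceFinset]
    exact ⟨e.2, (Finset.mem_filter.1 he).2⟩
  · rw [SimpleGraph.mem_incidenceFinset] at he
    exact ⟨⟨e, he.1⟩, Finset.mem_filter.2 ⟨Finset.mem_univ _, he.2⟩, rfl⟩

lemma intForm_boundaryForm_nonneg (U : Finset V) {x : G.edgeSet → ℝ}
    (hx : ∀ e, 0 ≤ x e ∧ x e ≤ 1) : 0 ≤ intForm (boundaryForm G U) x :=
  Finset.sum_nonneg fun e _ => mul_nonneg (Int.cast_nonneg (Int.natCast_nonneg _)) (hx e).1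

lemma intForm_boundaryForm_le (U : Finset V) {x : G.edgeSet → ℝ}
    (hx : ∀ e, 0 ≤ x e ∧ x e ≤ 1) :
    intForm (boundaryForm G U) x ≤ Fintype.card G.edgeSet := by
  have : ∀ e ∈ Finset.univ, (boundaryForm G U e : ℝ) * x e ≤ 1 := by
    intro e _
    have h1 : boundaryForm G U e ≤ 1 := by
      simp only [boundaryForm]
      omega
    have h2 : (boundaryForm G U e : ℝ) ≤ 1 := by exact_mod_cast h1
    exact mul_le_one₀ h2 (hx e).1 (hx e).2
  simpa [intForm] using Finset.sum_le_sum this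

/-- A wrong value of the boundary sum at one vertex is refuted by branching on its edges. -/
lemma cpRefutable_boundary_singleton (l : V → ZMod 2) (v : V) (k : ℤ) (hk : (k : ZMod 2) ≠ l v) :
    CPRefutable (satPolytope (tseitin G l) ∩ {x | intForm (boundaryForm G {v}) x = k})
      (2 ^ G.maxDegree - 1) := by
  have hcomp : IsCompact
      (satPolytope (tseitin G l) ∩ {x | intForm (boundaryForm G {v}) x = k}) :=
    (isCompact_satPolytope _).inter_right (isClosed_eq (continuous_intForm _) continuous_const)
  refine (cpRefutable_of_forall_assignment (edgesAt G v) hcomp (fun x hx => hx.1.2)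
    fun S hS x hx h1 h0 => ?_).mono hcomp subset_rfl ?_
  · have hsum : intForm (boundaryForm G {v}) x = S.card := by
      have hform : intForm (boundaryForm G {v}) x = ∑ e ∈ edgesAt G v, x e := by
        simp [intForm, boundaryForm_singleton, Finset.sum_ite_mem]
      rw [hform, ← Finset.sum_sdiff hS, Finset.sum_eq_zero h0, Finset.sum_congr rfl h1]
      simp
    have hkS : k = S.card := by
      have hxk : intForm (boundaryForm G {v}) x = k := hx.2
      exact_mod_cast hxk.symm.trans hsum
    -- At an assignment with support `S` the boundary sum is `S.card`, so `S` has the wrong parity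
    -- and its clause reads `1 ≤ 0`.
    have hclause := hx.1.1 ⟨edgesAt G v \ S, S⟩ ⟨v, S, hS, by simpa [hkS] using hk, rfl⟩
    simp only at hclause
    rw [Finset.sum_eq_zero h0, Finset.sum_eq_zero fun i hi => by rw [h1 i hi, sub_self]] at hclause
    norm_num at hclause
  · rw [card_edgesAt]
    exact Nat.sub_le_sub_right (Nat.pow_le_pow_right two_pos (G.degree_le_maxDegree v)) 1

/-- A boundary sum whose parity contradicts the parities of the vertices is refuted by halving the
vertex set. -/
lemma cpRefutable_boundary (l : V → ZMod 2) (d : ℕ) (U : Finset V) (hU : U.card ≤ 2 ^ d) (k : ℤ)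
    (hk : (k : ZMod 2) ≠ ∑ v ∈ U, l v) :
    CPRefutable (satPolytope (tseitin G l) ∩ {x | intForm (boundaryForm G U) x = k})
      ((Fintype.card G.edgeSet + 1) ^ (2 * d) * (2 * 2 ^ G.maxDegree) - 1) := by
  set m := Fintype.card G.edgeSet
  set K := satPolytope (tseitin G l)
  have hK : IsCompact K := isCompact_satPolytope _
  have hclosed : ∀ (U : Finset V) (k : ℤ), IsClosed {x | intForm (boundaryForm G U) x = k} :=
    fun _ _ => isClosed_eq (continuous_intForm _) continuous_const
  induction d generalizing U k with
  | zero =>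
    rcases U.eq_empty_or_nonempty with rfl | hne
    · refine cpRefutable_of_eq_empty (Set.eq_empty_iff_forall_notMem.2 fun x hx => hk ?_) _
      have hxk : intForm (boundaryForm G ∅) x = k := hx.2
      rw [boundaryForm_empty] at hxk
      have hk0 : k = 0 := by
        simp only [intForm, Pi.zero_apply, Int.cast_zero, zero_mul, Finset.sum_const_zero] at hxk
        exact_mod_cast hxk.symm
      simp [hk0]
    · obtain ⟨v, rfl⟩ := Finset.card_eq_one.1 (le_antisymm hU hne.card_pos)
      refine (cpRefutable_boundary_singleton G l v k (by simpa using hk)).mono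
        (hK.inter_right (hclosed _ k)) subset_rfl (Nat.sub_le_sub_right ?_ 1)
      rw [mul_zero, pow_zero, one_mul]
      exact Nat.le_mul_of_pos_left _ two_pos
  | succ d ih =>
    obtain ⟨U₁, hU₁, hcard₁⟩ := Finset.exists_subset_card_eq (s := U) (n := U.card / 2)
      (Nat.div_le_self _ _)
    set U₂ := U \ U₁ with hU₂
    have hdisj : Disjoint U₁ U₂ := Finset.disjoint_sdiff
    have hunion : U₁ ∪ U₂ = U := Finset.union_sdiff_of_subset hU₁
    have hcard₂ : U₂.card = U.card - U.card / 2 := by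
      rw [hU₂, Finset.card_sdiff_of_subset hU₁, hcard₁]
    rw [pow_succ] at hU
    set N := (m + 1) ^ (2 * d) * (2 * 2 ^ G.maxDegree) - 1 with hN
    have hN1 : N + 1 = (m + 1) ^ (2 * d) * (2 * 2 ^ G.maxDegree) :=
      Nat.sub_add_cancel (Nat.succ_le_of_lt (by positivity))
    -- The factor 2 in the bound serves this step: room for the final half-integer cut even when the
    -- maximum degree is 0.
    have hNpos : 1 ≤ N := by
      have h1 : 1 ≤ (m + 1) ^ (2 * d) := Nat.one_le_pow _ _ (by omega)
      have h2 : 1 ≤ 2 ^ G.maxDegree := Nat.one_le_two_pow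
      have h3 : 1 * (2 * 1) ≤ (m + 1) ^ (2 * d) * (2 * 2 ^ G.maxDegree) := by gcongr
      omega
    have hN2 : (m + 1) * (N + 1) = ((m + 1) * (N + 1) - 1) + 1 :=
      (Nat.sub_add_cancel (Nat.succ_le_of_lt (by positivity))).symm
    have hF := hK.inter_right (hclosed U k)
    refine CPRefutable.of_forall_face (a := boundaryForm G U₁) (M := m)
      (N := (m + 1) * (N + 1) - 1) hF
      (fun x hx => intForm_boundaryForm_nonneg G U₁ hx.1.2)
      (fun x hx => intForm_boundaryForm_le G U₁ hx.1.2) (fun k₁ => ?_) ?_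
    swap
    · rw [← hN2, hN1, Nat.sub_add_cancel (Nat.succ_le_of_lt (by positivity))]
      exact le_of_eq (by ring)
    have hF₁ := hF.inter_right (hclosed U₁ k₁)
    refine CPRefutable.of_forall_face (a := boundaryForm G U₂) (M := m) (N := N) hF₁
      (fun x hx => intForm_boundaryForm_nonneg G U₂ hx.1.1.2)
      (fun x hx => intForm_boundaryForm_le G U₂ hx.1.1.2) (fun k₂ => ?_) hN2.le
    by_cases h₁ : (k₁ : ZMod 2) = ∑ v ∈ U₁, l v
    swap
    · exact (ih U₁ (by omega) k₁ h₁).mono (hK.inter_right (hclosed U₁ k₁))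
        (fun x hx => ⟨hx.1.1.1, hx.1.2⟩) le_rfl
    by_cases h₂ : (k₂ : ZMod 2) = ∑ v ∈ U₂, l v
    swap
    · exact (ih U₂ (by omega) k₂ h₂).mono (hK.inter_right (hclosed U₂ k₂))
        (fun x hx => ⟨hx.1.1.1, hx.2⟩) le_rfl
    -- Both halves have the right parity and `k` the wrong one, so `k₁ + k₂ - k` is odd and equals
    -- `2 b x` throughout the face.
    obtain ⟨b, hb⟩ := exists_boundaryForm_add G hdisj
    rw [hunion] at hb
    have hodd : ¬ (2 : ℤ) ∣ k₁ + k₂ - k := by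
      intro h
      have h' : ((k₁ + k₂ - k : ℤ) : ZMod 2) = 0 :=
        (ZMod.intCast_zmod_eq_zero_iff_dvd _ 2).2 (by exact_mod_cast h)
      push_cast at h'
      rw [h₁, h₂, ← Finset.sum_union hdisj, hunion, sub_eq_zero] at h'
      exact hk h'.symm
    refine (cpRefutable_of_forall_ne_int (a := b) (r := (k₁ + k₂ - k) / 2) (fun j hj => ?_)
      fun x hx => ?_).mono (hF₁.inter_right (hclosed U₂ k₂)) subset_rfl hNpos
    · refine hodd ⟨j, ?_⟩
      have : (k₁ + k₂ - k : ℝ) = 2 * j := by linarith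
      exact_mod_cast this
    · obtain ⟨⟨⟨_, hxU⟩, hx₁⟩, hx₂⟩ := hx
      have h := congrArg (fun a => intForm a x) hb
      simp only [intForm_add, intForm_nsmul] at h
      rw [Set.mem_ofPred_eq] at hxU hx₁ hx₂
      rw [hxU, hx₁, hx₂] at h
      push_cast at h
      linarith

/-- Every edge has both ends in `V`, so the face `x(δV) = 0` is the whole polytope, while the
parities demand an odd value. -/
lemma cpRefutable_satPolytope_tseitin (l : V → ZMod 2) (hl : ∑ v, l v = 1) :
    CPRefutable (satPolytope (tseitin G l))
      ((Fintype.card G.edgeSet + 1) ^ (2 * Nat.clog 2 (Fintype.card V)) *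
        (2 * 2 ^ G.maxDegree)) := by
  refine (cpRefutable_boundary G l (Nat.clog 2 (Fintype.card V)) Finset.univ
    (Nat.le_pow_clog one_lt_two _) 0 (by simp [hl])).mono
    ((isCompact_satPolytope _).inter_right (isClosed_eq (continuous_intForm _) continuous_const))
    (fun x hx => ⟨hx, ?_⟩) (Nat.sub_le _ _)
  simp [boundaryForm_univ, intForm]

/-- For maximum degree 0 and at least two vertices the claimed bound is 0, so no cut may be spent.
An isolated vertex of parity 1 supplies the empty clause. -/
lemma satPolytope_tseitin_eq_empty (l : V → ZMod 2) (hl : ∑ v, l v = 1) (h : G.maxDegree = 0) :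
    satPolytope (tseitin G l) = ∅ := by
  obtain ⟨v, -, hv⟩ := Finset.exists_ne_zero_of_sum_ne_zero (hl ▸ one_ne_zero : ∑ v, l v ≠ 0)
  have hcard : edgesAt G v = ∅ := by
    rw [← Finset.card_eq_zero, card_edgesAt]
    exact Nat.le_zero.1 (h ▸ G.degree_le_maxDegree v)
  refine Set.eq_empty_iff_forall_notMem.2 fun x hx => ?_
  have := hx.1 ⟨edgesAt G v \ ∅, ∅⟩ ⟨v, ∅, Finset.empty_subset _, by simpa using hv.symm, rfl⟩
  simp only [hcard, Finset.sdiff_empty, Finset.sum_empty, add_zero] at this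
  norm_num at this

end Tseitin

/-! ### Numerical estimates and conclusion -/

lemma clog_two_le_three_mul_log {n : ℕ} (hn : 2 ≤ n) :
    (Nat.clog 2 n : ℝ) ≤ 3 * Real.log n := by
  have h1 : 2 ^ (Nat.clog 2 n - 1) < n := Nat.pow_pred_clog_lt_self one_lt_two hn
  have h2 : 1 ≤ Nat.clog 2 n := Nat.clog_pos one_lt_two hn
  have h3 : ((Nat.clog 2 n - 1 : ℕ) : ℝ) * Real.log 2 ≤ Real.log n := by
    rw [← Real.log_pow]
    exact Real.log_le_log (by positivity) (by exact_mod_cast h1.le)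
  have h4 : Real.log 2 ≤ Real.log n := Real.log_le_log two_pos (by exact_mod_cast hn)
  have h5 := Real.log_two_gt_d9
  rw [Nat.cast_sub h2] at h3
  push_cast at h3
  nlinarith

/-- With `d = Nat.clog 2 n ≥ 1`, the bounds `m + 1 ≤ B ^ 2` and `2 ≤ B` give the exponent `4 * d + 1
≤ 5 * d`, and `d ≤ 3 * log n` turns 5 into 15. -/
lemma succ_pow_two_mul_clog_le {m B n : ℕ} (hn : 2 ≤ n) (hB : 2 ≤ B) (hm : m ≤ B) :
    (((m + 1) ^ (2 * Nat.clog 2 n) * 2 : ℕ) : ℝ) ≤ (B : ℝ) ^ (15 * Real.log n) := by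
  have hd : 1 ≤ Nat.clog 2 n := Nat.clog_pos one_lt_two hn
  have hB1 : (1 : ℝ) ≤ B := by exact_mod_cast one_le_two.trans hB
  have hmB : m + 1 ≤ B ^ 2 := by nlinarith
  have hnat : (m + 1) ^ (2 * Nat.clog 2 n) * 2 ≤ B ^ (5 * Nat.clog 2 n) := calc
    (m + 1) ^ (2 * Nat.clog 2 n) * 2 ≤ (B ^ 2) ^ (2 * Nat.clog 2 n) * B := by gcongr
    _ = B ^ (4 * Nat.clog 2 n + 1) := by rw [← pow_mul, ← pow_succ]; congr 1; ring
    _ ≤ B ^ (5 * Nat.clog 2 n) := Nat.pow_le_pow_right (by omega) (by omega)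
  calc (((m + 1) ^ (2 * Nat.clog 2 n) * 2 : ℕ) : ℝ)
      ≤ ((B ^ (5 * Nat.clog 2 n) : ℕ) : ℝ) := by exact_mod_cast hnat
    _ = (B : ℝ) ^ ((5 * Nat.clog 2 n : ℕ) : ℝ) := by rw [Real.rpow_natCast]; push_cast; rfl
    _ ≤ (B : ℝ) ^ (15 * Real.log n) := by
        refine Real.rpow_le_rpow_of_exponent_le hB1 ?_
        have := clog_two_le_three_mul_log hn
        push_cast
        linarith

theorem theorem2 :
    ∃ C : ℝ, 0 < C ∧
      ∀ (V : Type*) [Fintype V] [DecidableEq V] (G : SimpleGraph V) [DecidableRel G.Adj]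
        (l : V → ZMod 2), ∑ v, l v = 1 →
        ∃ L : List (G.edgeSet → ℤ), IsCPRefutation (tseitin G l) L ∧
          (L.length : ℝ) ≤ 2 ^ G.maxDegree *
            ((Fintype.card V : ℝ) * (G.maxDegree : ℝ)) ^
              (C * Real.log (Fintype.card V : ℝ)) := by
  refine ⟨15, by norm_num, fun V _ _ G _ l hl => ?_⟩
  rcases Nat.eq_zero_or_pos G.maxDegree with h0 | hpos
  · refine ⟨[], satPolytope_tseitin_eq_empty G l hl h0, ?_⟩
    rw [List.length_nil, Nat.cast_zero]
    positivity
  have hne : Nonempty V := by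
    by_contra h
    rw [not_nonempty_iff] at h
    simp at hl
  have hn : 2 ≤ Fintype.card V := by
    have := G.maxDegree_lt_card_verts
    omega
  obtain ⟨L, hL, hlen⟩ := cpRefutable_satPolytope_tseitin G l hl
  refine ⟨L, hL, ?_⟩
  have hbound := succ_pow_two_mul_clog_le hn (B := Fintype.card V * G.maxDegree)
    (hn.trans (Nat.le_mul_of_pos_right _ hpos)) (card_edgeSet_le G)
  calc (L.length : ℝ)
      ≤ (((Fintype.card G.edgeSet + 1) ^ (2 * Nat.clog 2 (Fintype.card V)) *
          (2 * 2 ^ G.maxDegree) : ℕ) : ℝ) := by exact_mod_cast hlen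
    _ = 2 ^ G.maxDegree *
          (((Fintype.card G.edgeSet + 1) ^ (2 * Nat.clog 2 (Fintype.card V)) * 2 : ℕ) : ℝ) := by
        push_cast
        ring
    _ ≤ _ := by
        push_cast at hbound ⊢
        gcongr
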